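/- Let $d\ge 2$ be a fixed integer. For $k\ge 0$ let $G_k$ be the rooted tree of height $k$ in which every vertex at level $i<k$ has exactly $d$ children (so level $i$ has $d^i$ vertices), with all edges directed away from the root, together with a sink vertex $z$ to which every vertex at level $k$ is joined; the root $v$ is the source. Diffusion limited aggregation (DLA) on $G_k$ is the following process. Initially $z$ is the only occupied vertex. At each step $t=1,2,\dots$ a particle is placed at $v$ and, independently of the past walks, performs a directed random walk: at a vertex $u$ of level $i<k$ it chooses one of the $d$ children of $u$ uniformly at random, and from level $k$ it chooses $z$. If the chosen vertex is unoccupied the particle moves to it; if it is occupied the particle halts at $u$, and $u$ becomes occupied. The process stops at the finish time $t_f$, the first step $t$ at which $v$ becomes occupied. Let $T_f=T_f(k)=\sqrt{k}\,d^{\,k-\sqrt{2k}}$. Then for every function $\omega=\omega(k)$ with $\omega(k)\to\infty$ as $k\to\infty$, $$\lim_{k\to\infty}\Pr\left(\frac{T_f}{\omega}\le t_f\le \omega\,T_f\right)=1 .$$ In particular, for $d=2$ the Hastings–Halsey estimate $H(k)=\sqrt{2k}\,2^{\,k-\sqrt{2k}}$ is of the correct order: for every $\omega(k)\to\infty$,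 $\lim_{k\to\infty}\Pr\left(H/\omega\le t_f\le\omega H\right)=1$. -/

import Mathlib

open Filter Topology MeasureTheory ProbabilityTheory

noncomputable section

namespace DLA

/-- Vertices of the rooted `d`-ary tree of height `k` with a sink attached to the leaves.
`some u` is the tree vertex at level `u.length` reached from the root by successively taking the
children labelled by the entries of `u` (so the children of `u` are the lists `u ++ [a]`, there are
`d ^ i` vertices at level `i ≤ k`, and the leaves form level `k`); `none` is the sink. -/
abbrev Vertex (d k : ℕ) : Type := Option {u : List (Fin d) // u.length ≤ k}

/-- The source of the particles: the root of the tree. -/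
def source (d k : ℕ) : Vertex d k := some ⟨[], Nat.zero_le k⟩

/-- The sink. -/
def sink (d k : ℕ) : Vertex d k := none

/-- A directed walk from source to sink: the label of the child chosen at each of the levels
`0, …, k - 1`; from level `k` the walk goes to the sink. -/
abbrev Walk (d k : ℕ) : Type := Fin k → Fin d

variable {d k : ℕ}

/-- The vertex visited by the walk after `i` moves (a tree vertex at level `i` if `i ≤ k`,
and the sink if `i > k`). -/
def Walk.vertex (r : Walk d k) (i : ℕ) : Vertex d k :=
  if i ≤ k then
    some ⟨(List.ofFn r).take i, by simp⟩
  else sink d k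

/-- The level at which a particle following the walk `r` halts when `C` is the set of occupied
vertices: the first level for which the next vertex of the walk is occupied. -/
def haltLevel (C : Set (Vertex d k)) (r : Walk d k) : ℕ :=
  sInf {i : ℕ | r.vertex (i + 1) ∈ C}

open Classical in
/-- The cluster of occupied vertices after `t` particles, particle `s` (`s = 0, 1, …`) following the
walk `ρ s`. Initially only the sink is occupied; the process stops once the source is occupied. -/
def cluster (ρ : ℕ → Walk d k) : ℕ → Set (Vertex d k)
  | 0 => {sink d k}
  | t + 1 =>
      if source d k ∈ cluster ρ t then cluster ρ t
      else insert ((ρ t).vertex (haltLevel (cluster ρ t) (ρ t))) (cluster ρ t)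

/-- The finish time: the first step at which the source is occupied. -/
def finishTime (ρ : ℕ → Walk d k) : ℕ := sInf {t : ℕ | source d k ∈ cluster ρ t}

lemma sink_mem_cluster (ρ : ℕ → Walk d k) (t : ℕ) : sink d k ∈ cluster ρ t := by
  induction t with
  | zero => simp [cluster]
  | succ t ih =>
    rw [cluster]
    split_ifs
    · exact ih
    · exact Set.mem_insert_of_mem _ ih

lemma halt_notMem (ρ : ℕ → Walk d k) (t : ℕ) (h : source d k ∉ cluster ρ t) :
    (ρ t).vertex (haltLevel (cluster ρ t) (ρ t)) ∉ cluster ρ t := by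
  rcases hl : haltLevel (cluster ρ t) (ρ t) with _ | m
  · simpa [Walk.vertex, source] using h
  · intro hm
    have : haltLevel (cluster ρ t) (ρ t) ≤ m := Nat.sInf_le hm
    omega

/-- The process always terminates, so the set defining `finishTime` is never empty. -/
lemma exists_source_mem_cluster (ρ : ℕ → Walk d k) : ∃ t, source d k ∈ cluster ρ t := by
  by_contra! h
  have : Finite {u : List (Fin d) // u.length ≤ k} := (List.finite_length_le (Fin d) k).to_subtype
  have hcard : ∀ t, t ≤ (cluster ρ t).ncard := by
    intro t
    induction t with
    | zero => exact Nat.zero_le _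
    | succ t ih =>
      rw [cluster, if_neg (h t), Set.ncard_insert_of_notMem (halt_notMem ρ t (h t))]
      omega
  have h1 := hcard (Nat.card (Vertex d k) + 1)
  have h2 := Set.ncard_le_card (cluster ρ (Nat.card (Vertex d k) + 1))
  omega

variable (d k)

/-- The law of the sequence of walks: the walks are independent, and within each walk every child is
chosen independently and uniformly among the `d` children of the current vertex. -/
def walkLaw : Measure (ℕ → Walk d k) :=
  Measure.infinitePi fun _ : ℕ => Measure.pi fun _ : Fin k => uniformOn (Set.univ : Set (Fin d))

/-- The event `T / w ≤ t_f ≤ w T`. -/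
def finishWithin (w T : ℝ) : Set (ℕ → Walk d k) :=
  {ρ | T / w ≤ (finishTime ρ : ℝ) ∧ (finishTime ρ : ℝ) ≤ w * T}

/-- `T_f = √k d^{k - √(2k)}`. -/
def Tf : ℝ := √(k : ℝ) * (d : ℝ) ^ ((k : ℝ) - √(2 * (k : ℝ)))

/-- The Hastings–Halsey estimate `√(2k) 2^{k - √(2k)}` for binary trees of height `k`. -/
def hastingsHalsey : ℝ := √(2 * (k : ℝ)) * (2 : ℝ) ^ ((k : ℝ) - √(2 * (k : ℝ)))

end DLA

end

/-! Off the leaf level, a vertex gets occupied only when a particle on it heads for an occupied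
child. So the root can be occupied only after the vertices of some leaf-to-root path have been hit
at levels `k, k, k - 1, …, 1`, in this order (`exists_hits_of_mem_cluster`). Conversely, ordered
hits always push occupation up a path, because an occupied vertex higher on the path only helps
(`occupiedBelow_of_hits`).

Early finish: a first moment over the lowest hits only. For `M = ⌊√(2k)⌋ + 1`, summing over leaves
cancels the probability of the first hit, so a finish by time `t` has probability at most `(t choose
M + 1) d ^ (-(k + (k - 1) + ⋯ + (k - M + 1)))`. At `t ≤ T_f / w` this is at most `e / w` when `w ≥
e` (`walkLaw_early`).

Late finish: let `m = ⌊√(2k)⌋` and `i = k - m`. Condition on the first `i` moves of the first `2 d ^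
i (1 + m d ^ 3)` walks. By pigeonhole there are `d ^ i` disjoint groups of `1 + m d ^ 3` walks with
a common prefix. The groups climb from a leaf to level `i` independently, and the expected number of
successes is at least `m exp(-d ^ 3)`, so some group very likely succeeds
(`walkLaw_not_occupiedBelow`). From level `i` the climb to the root uses windows of lengths `m d ^
(i - b)`, which are summable, and each fails with probability at most `exp(-m)`
(`walkLaw_lt_finishTime_le`). The total time is `O(m d ^ (k - m))`, which is of order `T_f`. -/

noncomputable section

namespace DLA

/-! ### Cylinders of walks with a common initial segment -/

variable {d k : ℕ}

/-- The walks that follow `r` during the first `l` moves. -/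
def cyl (r : Walk d k) (l : ℕ) : Set (Walk d k) := {x | ∀ j : Fin k, (j : ℕ) < l → x j = r j}

lemma self_mem_cyl (r : Walk d k) (l : ℕ) : r ∈ cyl r l := fun _ _ => rfl

lemma mem_cyl_symm {r x : Walk d k} {l : ℕ} (h : x ∈ cyl r l) : r ∈ cyl x l :=
  fun j hj => (h j hj).symm

lemma mem_cyl_trans {r x y : Walk d k} {l : ℕ} (h : x ∈ cyl y l) (h' : y ∈ cyl r l) : x ∈ cyl r l :=
  fun j hj => (h j hj).trans (h' j hj)

lemma cyl_anti (r : Walk d k) {l l' : ℕ} (h : l ≤ l') : cyl r l' ⊆ cyl r l :=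
  fun _ hx j hj => hx j (hj.trans_le h)

lemma vertex_eq_of_mem_cyl {r x : Walk d k} {l i : ℕ} (h : x ∈ cyl r l) (hi : i ≤ l) :
    x.vertex i = r.vertex i := by
  unfold Walk.vertex
  split_ifs with hk
  · congr 2
    apply List.ext_getElem
    · simp
    · intro n h1 h2
      simp only [List.length_take, List.length_ofFn, lt_inf_iff] at h1
      simp only [List.getElem_take, List.getElem_ofFn]
      exact h ⟨n, h1.2⟩ (h1.1.trans_le hi)
  · rfl

lemma mem_cyl_of_vertex_eq {r x : Walk d k} {i : ℕ} (hi : i ≤ k) (h : x.vertex i = r.vertex i) :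
    x ∈ cyl r i := by
  intro j hj
  simp only [Walk.vertex, if_pos hi, Option.some.injEq, Subtype.mk.injEq] at h
  have h1 : ((List.ofFn x).take i)[(j : ℕ)]? = ((List.ofFn r).take i)[(j : ℕ)]? := by rw [h]
  simpa [List.getElem?_take, hj] using h1

lemma eq_of_vertex_eq {r x : Walk d k} {i l : ℕ} (hi : i ≤ k) (hl : l ≤ k)
    (h : x.vertex i = r.vertex l) : i = l := by
  simp only [Walk.vertex, if_pos hi, if_pos hl, Option.some.injEq, Subtype.mk.injEq] at h
  have h1 := congrArg List.length h
  simpa [hi, hl] using h1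

lemma vertex_zero (r : Walk d k) : r.vertex 0 = source d k := by
  simp [Walk.vertex, source]

/-! ### Deterministic growth of the cluster along a path -/

lemma vertex_haltLevel_succ_mem (ρ : ℕ → Walk d k) (t : ℕ) (r : Walk d k) :
    r.vertex (haltLevel (cluster ρ t) r + 1) ∈ cluster ρ t := by
  have : {i : ℕ | r.vertex (i + 1) ∈ cluster ρ t}.Nonempty :=
    ⟨k, by simpa [Walk.vertex] using sink_mem_cluster ρ t⟩
  exact Nat.sInf_mem this

lemma haltLevel_le (ρ : ℕ → Walk d k) (t : ℕ) (r : Walk d k) : haltLevel (cluster ρ t) r ≤ k :=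
  Nat.sInf_le (by simpa [Walk.vertex] using sink_mem_cluster ρ t)

lemma cluster_mono (ρ : ℕ → Walk d k) : Monotone (cluster ρ) := by
  refine monotone_nat_of_le_succ fun t => ?_
  rw [cluster]
  split_ifs
  · exact le_rfl
  · exact Set.subset_insert _ _

lemma source_mem_of_finishTime_le (ρ : ℕ → Walk d k) {t : ℕ} (h : finishTime ρ ≤ t) :
    source d k ∈ cluster ρ t :=
  cluster_mono ρ h (Nat.sInf_mem (exists_source_mem_cluster ρ))

/-- Some vertex of level at most `l` on the walk `r` is occupied after `t` particles. -/
def OccupiedBelow (ρ : ℕ → Walk d k) (t : ℕ) (r : Walk d k) (l : ℕ) : Prop :=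
  ∃ i ≤ l, r.vertex i ∈ cluster ρ t

lemma OccupiedBelow.mono {ρ : ℕ → Walk d k} {t t' : ℕ} {r : Walk d k} {l : ℕ}
    (h : OccupiedBelow ρ t r l) (ht : t ≤ t') : OccupiedBelow ρ t' r l :=
  let ⟨i, hi, hm⟩ := h
  ⟨i, hi, cluster_mono ρ ht hm⟩

lemma OccupiedBelow.congr {ρ : ℕ → Walk d k} {t : ℕ} {r x : Walk d k} {l : ℕ}
    (h : OccupiedBelow ρ t r l) (hx : x ∈ cyl r l) : OccupiedBelow ρ t x l :=
  let ⟨i, hi, hm⟩ := h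
  ⟨i, hi, by rwa [vertex_eq_of_mem_cyl hx hi]⟩

lemma occupiedBelow_of_haltLevel_le (ρ : ℕ → Walk d k) {s l : ℕ}
    (h : haltLevel (cluster ρ s) (ρ s) ≤ l) : OccupiedBelow ρ (s + 1) (ρ s) l := by
  by_cases hs : source d k ∈ cluster ρ s
  · exact ⟨0, Nat.zero_le _, by rw [vertex_zero]; exact cluster_mono ρ (Nat.le_succ s) hs⟩
  · refine ⟨_, h, ?_⟩
    rw [cluster, if_neg hs]
    exact Set.mem_insert _ _

lemma occupiedBelow_height (ρ : ℕ → Walk d k) (s : ℕ) : OccupiedBelow ρ (s + 1) (ρ s) k :=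
  occupiedBelow_of_haltLevel_le ρ (haltLevel_le ρ s _)

/-- If the occupied vertex is at level `l + 1`, a walk through it must halt at level `l` or earlier,
and its first `l` moves agree with `r`. Asking only for occupation at or above a level makes the
statement insensitive to all other particles. -/
lemma OccupiedBelow.step {ρ : ℕ → Walk d k} {t s : ℕ} {r : Walk d k} {l : ℕ}
    (h : OccupiedBelow ρ t r (l + 1)) (ht : t ≤ s) (hs : ρ s ∈ cyl r (l + 1)) :
    OccupiedBelow ρ (s + 1) r l := by
  obtain ⟨i, hi, hm⟩ := h.mono ht
  rcases hi.lt_or_eq with hi | rfl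
  · exact ⟨i, Nat.lt_succ_iff.1 hi, cluster_mono ρ (Nat.le_succ s) hm⟩
  · rw [← vertex_eq_of_mem_cyl hs le_rfl] at hm
    exact (occupiedBelow_of_haltLevel_le ρ (Nat.sInf_le hm)).congr
      (mem_cyl_symm (cyl_anti r (Nat.le_succ l) hs))

lemma OccupiedBelow.finishTime_le {ρ : ℕ → Walk d k} {t : ℕ} {r : Walk d k}
    (h : OccupiedBelow ρ t r 0) : finishTime ρ ≤ t := by
  obtain ⟨i, hi, hm⟩ := h
  obtain rfl := Nat.le_zero.1 hi
  exact Nat.sInf_le (by rwa [vertex_zero] at hm)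

/-- Hits of the vertices of `r` at levels `k, k - 1, …`, in this order, occupy the path upwards. -/
lemma occupiedBelow_of_hits {ρ : ℕ → Walk d k} {t : ℕ} {r : Walk d k} {l : ℕ} (a : ℕ → ℕ)
    (h : OccupiedBelow ρ t r l) (n : ℕ) (hn : n ≤ l) (h0 : ∀ b < n, t ≤ a b)
    (ha : ∀ b c, b < c → c < n → a b < a c) (hhit : ∀ b < n, ρ (a b) ∈ cyl r (l - b))
    {t' : ℕ} (htt : t ≤ t') (ht' : ∀ b < n, a b < t') : OccupiedBelow ρ t' r (l - n) := by
  induction n generalizing t' with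
  | zero => exact h.mono htt
  | succ n ih =>
    have h1 : OccupiedBelow ρ (a n) r (l - n) :=
      ih (by omega) (fun b hb => h0 b (by omega)) (fun b c hbc hc => ha b c hbc (by omega))
        (fun b hb => hhit b (by omega)) (h0 n (by omega)) (fun b hb => ha b n hb (by omega))
    have h2 : l - n = l - (n + 1) + 1 := by omega
    have h3 := hhit n (by omega)
    rw [h2] at h1 h3
    exact (h1.step le_rfl h3).mono (ht' n (by omega))

/-- Every occupied vertex is explained by a chain of hits going up from a leaf. -/
lemma exists_hits_of_mem_cluster (ρ : ℕ → Walk d k) (t : ℕ) (r : Walk d k) (l m : ℕ) (hlm : l + m = k)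
    (h : r.vertex l ∈ cluster ρ t) :
    ∃ (x : Walk d k) (a : ℕ → ℕ), x ∈ cyl r l ∧ (∀ j < m, a j < a (j + 1)) ∧ a m < t ∧
      ∀ j ≤ m, ρ (a j) ∈ cyl x (k - (j - 1)) := by
  induction t generalizing r l m with
  | zero =>
    have : l ≤ k := by omega
    simp [cluster, Walk.vertex, sink, this] at h
  | succ t ih =>
    have hold : r.vertex l ∈ cluster ρ t → ∃ (x : Walk d k) (a : ℕ → ℕ), x ∈ cyl r l ∧
        (∀ j < m, a j < a (j + 1)) ∧ a m < t + 1 ∧ ∀ j ≤ m, ρ (a j) ∈ cyl x (k - (j - 1)) := by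
      intro h
      obtain ⟨x, a, h1, h2, h3, h4⟩ := ih r l m hlm h
      exact ⟨x, a, h1, h2, h3.trans (Nat.lt_succ_self t), h4⟩
    rw [cluster] at h
    split_ifs at h with hs
    · exact hold h
    rcases h with h | h
    swap
    · exact hold h
    have hk := haltLevel_le ρ t (ρ t)
    have hl := eq_of_vertex_eq (by omega) hk h
    have hmem := vertex_haltLevel_succ_mem ρ t (ρ t)
    rw [← hl] at h hmem
    have hcyl := mem_cyl_symm (mem_cyl_of_vertex_eq (by omega) h)
    rcases m with _ | m
    -- At a leaf only `j = 0` is constrained. The truncated `j - 1` gives levels `k, k, k - 1, …`: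
    -- the leaf is hit once to be occupied and once more to occupy its parent.
    · refine ⟨ρ t, fun _ => t, hcyl, by simp, by simp, fun j _ => self_mem_cyl _ _⟩
    -- The walk halts below an occupied vertex at level `l + 1`; the chain explaining that vertex is
    -- extended by time `t`.
    · obtain ⟨x, a, h1, h2, h3, h4⟩ := ih (ρ t) (l + 1) m (by omega) hmem
      refine ⟨x, fun j => if j ≤ m then a j else t, mem_cyl_trans (cyl_anti _ (Nat.le_succ l) h1) hcyl,
        ?_, by simp, ?_⟩
      · intro j hj
        rcases (Nat.lt_succ_iff.1 hj).lt_or_eq with hj' | rfl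
        · simpa [hj'.le, Nat.succ_le_iff.2 hj'] using h2 j hj'
        · simpa using h3
      · intro j hj
        dsimp only
        split_ifs with hjm
        · exact h4 j hjm
        · obtain rfl : j = m + 1 := by omega
          have : k - (m + 1 - 1) = l + 1 := by omega
          rw [this]
          exact mem_cyl_symm h1

/-! ### Independence of events determined by disjoint sets of times -/

lemma eq_preimage_image_of_dependsOn {W : Type*} {F : Set (ℕ → W)} {T : Finset ℕ}
    (hF : DependsOn (· ∈ F) (T : Set ℕ)) :
    F = (fun (ρ : ℕ → W) (s : T) => ρ s) ⁻¹' ((fun (ρ : ℕ → W) (s : T) => ρ s) '' F) := by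
  refine (Set.subset_preimage_image _ _).antisymm ?_
  rintro ρ ⟨ρ', hρ', h⟩
  exact (hF (x := ρ') (y := ρ) fun s hs => congrFun h ⟨s, hs⟩).mp hρ'

/-- Total probability over the values of `φ`. The product form of the hypothesis avoids dividing by
null fibers, and `B` need not be measurable. -/
lemma measureReal_le_of_forall_fiber {Ω V : Type*} [MeasurableSpace Ω] (μ : Measure Ω)
    [IsProbabilityMeasure μ] [Finite V] (φ : Ω → V) (hφ : ∀ v, MeasurableSet (φ ⁻¹' {v}))
    (B : Set Ω) (c : ℝ) (h : ∀ ω, μ.real (φ ⁻¹' {φ ω} ∩ B) ≤ c * μ.real (φ ⁻¹' {φ ω})) :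
    μ.real B ≤ c := by
  have := Fintype.ofFinite V
  have h1 : ∑ v : V, μ.real (φ ⁻¹' {v}) = 1 := by
    rw [← measureReal_biUnion_finset]
    · rw [show (⋃ v ∈ Finset.univ, φ ⁻¹' {v}) = Set.univ by ext; simp]
      simp
    · intro a _ b _ hab
      exact Disjoint.preimage _ (by simpa using hab)
    · exact fun v _ => hφ v
  have h2 : ∀ v : V, μ.real (φ ⁻¹' {v} ∩ B) ≤ c * μ.real (φ ⁻¹' {v}) := by
    intro v
    by_cases hv : ∃ ω, φ ω = v
    · obtain ⟨ω, rfl⟩ := hv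
      exact h ω
    · have : φ ⁻¹' {v} = ∅ := by
        ext ω
        simp only [Set.mem_preimage, Set.mem_singleton_iff, Set.mem_empty_iff_false, iff_false]
        exact fun hω => hv ⟨ω, hω⟩
      simp [this]
  calc μ.real B ≤ μ.real (⋃ v ∈ (Finset.univ : Finset V), (φ ⁻¹' {v} ∩ B)) :=
        measureReal_mono (fun ω hω => by simpa using hω) (measure_ne_top _ _)
    _ ≤ ∑ v : V, μ.real (φ ⁻¹' {v} ∩ B) := measureReal_biUnion_finset_le _ _
    _ ≤ ∑ v : V, c * μ.real (φ ⁻¹' {v}) := Finset.sum_le_sum fun v _ => h2 v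
    _ = c := by rw [← Finset.mul_sum, h1, mul_one]

section IID

variable {W : Type*} [Finite W] [MeasurableSpace W] [MeasurableSingletonClass W]

lemma measurableSet_of_dependsOn {F : Set (ℕ → W)} {T : Finset ℕ}
    (hF : DependsOn (· ∈ F) (T : Set ℕ)) : MeasurableSet F := by
  rw [eq_preimage_image_of_dependsOn hF]
  exact (measurable_pi_lambda _ fun s => measurable_pi_apply _) (Set.toFinite _).measurableSet

variable (ν : Measure W) [IsProbabilityMeasure ν]

lemma infinitePi_real_inter {F F' : Set (ℕ → W)} {T T' : Finset ℕ} (hT : Disjoint T T')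
    (hF : DependsOn (· ∈ F) (T : Set ℕ)) (hF' : DependsOn (· ∈ F') (T' : Set ℕ)) :
    (Measure.infinitePi fun _ : ℕ => ν).real (F ∩ F') =
      (Measure.infinitePi fun _ : ℕ => ν).real F * (Measure.infinitePi fun _ : ℕ => ν).real F' := by
  have h := (iIndepFun_infinitePi (P := fun _ : ℕ => ν) (X := fun _ x => x)
    (fun _ => measurable_id)).indepFun_finset T T' hT (fun s => measurable_pi_apply s)
  have h2 := h.measure_inter_preimage_eq_mul _ _
    (Set.toFinite ((fun (ρ : ℕ → W) (s : T) => ρ s) '' F)).measurableSet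
    (Set.toFinite ((fun (ρ : ℕ → W) (s : T') => ρ s) '' F')).measurableSet
  rw [← eq_preimage_image_of_dependsOn hF, ← eq_preimage_image_of_dependsOn hF'] at h2
  simp only [Measure.real, h2, ENNReal.toReal_mul]

lemma infinitePi_real_biInter {J : Type*} (S : Finset J) {F : J → Set (ℕ → W)} {T : J → Finset ℕ}
    (hT : (S : Set J).PairwiseDisjoint T) (hF : ∀ j ∈ S, DependsOn (· ∈ F j) (T j : Set ℕ)) :
    (Measure.infinitePi fun _ : ℕ => ν).real (⋂ j ∈ S, F j) =
      ∏ j ∈ S, (Measure.infinitePi fun _ : ℕ => ν).real (F j) := by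
  classical
  induction S using Finset.induction_on with
  | empty => simp
  | insert a S ha ih =>
    rw [Finset.prod_insert ha, Finset.set_biInter_insert,
      infinitePi_real_inter ν (T := T a) (T' := S.biUnion T), ih]
    · exact hT.subset (by simp)
    · exact fun j hj => hF j (Finset.mem_insert_of_mem hj)
    · rw [Finset.disjoint_biUnion_right]
      intro j hj
      exact hT (by simp) (by simp [hj]) (by rintro rfl; exact ha hj)
    · exact hF a (Finset.mem_insert_self _ _)
    · intro x y hxy
      simp only [Set.mem_iInter, eq_iff_iff]
      refine forall₂_congr fun j hj => ?_
      exact (hF j (Finset.mem_insert_of_mem hj) fun s hs =>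
        hxy s (Finset.mem_coe.2 (Finset.mem_biUnion.2 ⟨j, hj, hs⟩))).to_iff

lemma infinitePi_real_eval (s : ℕ) (A : Set W) :
    (Measure.infinitePi fun _ : ℕ => ν).real {ρ | ρ s ∈ A} = ν.real A := by
  have h := (measurePreserving_eval_infinitePi (fun _ : ℕ => ν) s).measure_preimage
    (Set.toFinite A).measurableSet.nullMeasurableSet
  simp only [Measure.real]
  rw [← h]
  rfl

lemma infinitePi_real_forall_mem (S : Finset ℕ) (A : ℕ → Set W) :
    (Measure.infinitePi fun _ : ℕ => ν).real {ρ | ∀ s ∈ S, ρ s ∈ A s} = ∏ s ∈ S, ν.real (A s) := by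
  have h := infinitePi_real_biInter ν S (F := fun s => {ρ | ρ s ∈ A s}) (T := fun s => {s})
    (by intro a _ b _ hab; simpa [Function.onFun] using hab)
    (by intro j _ x y hxy; simp only [Set.mem_ofPred_eq]; rw [hxy j (by simp)])
  simp only [infinitePi_real_eval] at h
  rw [← h]
  congr 1
  ext ρ
  simp

end IID

section Walks

variable (d k : ℕ) [NeZero d]

/-- The law of a single walk. -/
def stepLaw : Measure (Walk d k) :=
  Measure.pi fun _ : Fin k => uniformOn (Set.univ : Set (Fin d))

instance : IsProbabilityMeasure (stepLaw d k) := by unfold stepLaw; infer_instance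

instance : IsProbabilityMeasure (walkLaw d k) := by unfold walkLaw; infer_instance

variable {d k}

lemma stepLaw_real_cyl (r : Walk d k) {l : ℕ} (hl : l ≤ k) :
    (stepLaw d k).real (cyl r l) = ((d : ℝ)⁻¹) ^ l := by
  have h : cyl r l = Set.pi Set.univ fun j : Fin k => if (j : ℕ) < l then {r j} else Set.univ := by
    ext x
    simp only [cyl, Set.mem_ofPred_eq, Set.mem_pi, Set.mem_univ, true_imp_iff]
    refine forall_congr' fun j => ?_
    split_ifs with hj <;> simp [hj]
  have h1 : ∀ j : Fin k, uniformOn (Set.univ : Set (Fin d))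
      (if (j : ℕ) < l then {r j} else Set.univ) = if (j : ℕ) < l then (d : ENNReal)⁻¹ else 1 := by
    intro j
    split_ifs
    · rw [uniformOn_univ, Measure.count_singleton]; simp
    · exact measure_univ
  rw [Measure.real, stepLaw, h, Measure.pi_pi]
  simp_rw [h1]
  rw [Finset.prod_ite, Finset.prod_const, Finset.prod_const_one, mul_one, ENNReal.toReal_pow,
    ENNReal.toReal_inv, ENNReal.toReal_natCast, Fin.card_filter_val_lt, min_eq_right hl]

end Walks

/-! ### Early finish: first moment over chains of hits -/

/-- The increasing enumeration of a finite set of times. -/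
def enum (S : Finset ℕ) (j : ℕ) : ℕ := if h : j < S.card then S.orderEmbOfFin rfl ⟨j, h⟩ else 0

lemma enum_mem {S : Finset ℕ} {j : ℕ} (h : j < S.card) : enum S j ∈ S := by
  rw [enum, dif_pos h]
  exact Finset.orderEmbOfFin_mem _ _ _

lemma enum_lt_enum {S : Finset ℕ} {i j : ℕ} (hij : i < j) (h : j < S.card) :
    enum S i < enum S j := by
  rw [enum, enum, dif_pos h, dif_pos (hij.trans h)]
  exact (S.orderEmbOfFin rfl).strictMono hij

lemma enum_injOn (S : Finset ℕ) : Set.InjOn (enum S) (Set.Iio S.card) := by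
  intro a ha b hb hab
  rcases lt_trichotomy a b with h | h | h
  · exact absurd hab (enum_lt_enum h hb).ne
  · exact h
  · exact absurd hab (enum_lt_enum h ha).ne'

/-- An increasing sequence is recovered from its set of values, so the union bound can run over sets
of times and produce a binomial coefficient. -/
lemma enum_image {a : ℕ → ℕ} {n : ℕ} (ha : ∀ b c, b < c → c < n → a b < a c) :
    ((Finset.range n).image a).card = n ∧
      ∀ j < n, enum ((Finset.range n).image a) j = a j := by
  have hinj : Set.InjOn a (Finset.range n) := by
    intro x hx y hy hxy
    simp only [Finset.coe_range, Set.mem_Iio] at hx hy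
    rcases lt_trichotomy x y with h | h | h
    · exact absurd hxy (ha _ _ h hy).ne
    · exact h
    · exact absurd hxy (ha _ _ h hx).ne'
  have hc : ((Finset.range n).image a).card = n := by
    rw [Finset.card_image_of_injOn hinj, Finset.card_range]
  refine ⟨hc, fun j hj => ?_⟩
  rw [enum, dif_pos (by rwa [hc])]
  have := Finset.orderEmbOfFin_unique (s := (Finset.range n).image a) rfl
    (f := fun x => a x) (fun x => Finset.mem_image_of_mem _ (by
      rw [Finset.mem_range]; exact x.2.trans_eq hc))
    (fun x y hxy => ha x y hxy (y.2.trans_eq hc))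
  exact (congrFun this ⟨j, by rwa [hc]⟩).symm

section IID

variable {W : Type*} [Finite W] [MeasurableSpace W] [MeasurableSingletonClass W]
variable (ν : Measure W) [IsProbabilityMeasure ν]

lemma infinitePi_real_forall_lt_mem (n : ℕ) {e : ℕ → ℕ} (he : Set.InjOn e (Set.Iio n))
    (A : ℕ → Set W) :
    (Measure.infinitePi fun _ : ℕ => ν).real {ρ | ∀ j < n, ρ (e j) ∈ A j} =
      ∏ j ∈ Finset.range n, ν.real (A j) := by
  have h := infinitePi_real_biInter ν (Finset.range n) (F := fun j => {ρ | ρ (e j) ∈ A j})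
    (T := fun j => {e j})
    (by
      intro a ha b hb hab
      simp only [Function.onFun, Finset.disjoint_singleton_right, Finset.mem_singleton]
      intro h
      exact hab (he (by simpa using ha) (by simpa using hb) h.symm))
    (by intro j _ x y hxy; simp only [Set.mem_ofPred_eq]; rw [hxy (e j) (by simp)])
  simp only [infinitePi_real_eval] at h
  rw [← h]
  congr 1
  ext ρ
  simp

end IID

/-- First moment bound for an early finish. -/
lemma walkLaw_finishTime_le [NeZero d] {m : ℕ} (hm : m ≤ k) (t : ℕ) :
    (walkLaw d k).real {ρ | finishTime ρ ≤ t} ≤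
      (t.choose (m + 1) : ℝ) * ∏ j ∈ Finset.range m, ((d : ℝ)⁻¹) ^ (k - j) := by
  set E : Finset ℕ → Walk d k → Set (ℕ → Walk d k) := fun S x =>
    {ρ | ∀ j < m + 1, ρ (enum S j) ∈ cyl x (k - (j - 1))} with hE
  have hsub : {ρ : ℕ → Walk d k | finishTime ρ ≤ t} ⊆
      ⋃ S ∈ (Finset.range t).powersetCard (m + 1), ⋃ x ∈ (Finset.univ : Finset (Walk d k)), E S x := by
    intro ρ hρ
    have h0 := source_mem_of_finishTime_le ρ hρ
    rw [← vertex_zero (ρ 0)] at h0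
    obtain ⟨x, a, -, h1, h2, h3⟩ := exists_hits_of_mem_cluster ρ t (ρ 0) 0 k (by simp) h0
    have hmono : ∀ b c, b < c → c < k + 1 → a b < a c := by
      intro b c hbc hc
      induction c with
      | zero => omega
      | succ c ih =>
        rcases (Nat.lt_succ_iff.1 hbc).lt_or_eq with h | rfl
        · exact (ih h (by omega)).trans (h1 c (by omega))
        · exact h1 b (by omega)
    -- Only the first `m + 1` of the `k + 1` hits are kept.
    have hmono' : ∀ b c, b < c → c < m + 1 → a b < a c := fun b c hbc hc =>
      hmono b c hbc (by omega)
    obtain ⟨hc, he⟩ := enum_image hmono'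
    simp only [Set.mem_iUnion]
    refine ⟨(Finset.range (m + 1)).image a, ?_, x, Finset.mem_univ _, ?_⟩
    · rw [Finset.mem_powersetCard]
      refine ⟨fun s hs => ?_, hc⟩
      obtain ⟨j, hj, rfl⟩ := Finset.mem_image.1 hs
      rw [Finset.mem_range] at hj ⊢
      rcases (show j ≤ k by omega).lt_or_eq with h | rfl
      · exact (hmono j k h (by omega)).trans h2
      · exact h2
    · intro j hj
      rw [he j hj]
      exact h3 j (by omega)
  have hprob : ∀ S ∈ (Finset.range t).powersetCard (m + 1), ∀ x : Walk d k,
      (walkLaw d k).real (E S x) =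
        (∏ j ∈ Finset.range m, ((d : ℝ)⁻¹) ^ (k - j)) * ((d : ℝ)⁻¹) ^ k := by
    intro S hS x
    have hc := (Finset.mem_powersetCard.1 hS).2
    have h := infinitePi_real_forall_lt_mem (stepLaw d k) (m + 1) (e := enum S)
      (hc ▸ enum_injOn S) (fun j => cyl x (k - (j - 1)))
    rw [Finset.prod_range_succ'] at h
    refine h.trans ?_
    congr 1
    · exact Finset.prod_congr rfl fun j _ => stepLaw_real_cyl x (by omega)
    · exact stepLaw_real_cyl x (by omega)
  have hd : (d : ℝ) ≠ 0 := Nat.cast_ne_zero.2 (NeZero.ne d)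
  calc (walkLaw d k).real {ρ | finishTime ρ ≤ t}
      ≤ (walkLaw d k).real (⋃ S ∈ (Finset.range t).powersetCard (m + 1),
          ⋃ x ∈ (Finset.univ : Finset (Walk d k)), E S x) :=
        measureReal_mono hsub (measure_ne_top _ _)
    _ ≤ ∑ S ∈ (Finset.range t).powersetCard (m + 1), ∑ x : Walk d k, (walkLaw d k).real (E S x) :=
        (measureReal_biUnion_finset_le _ _).trans
          (Finset.sum_le_sum fun S _ => measureReal_biUnion_finset_le _ _)
    _ = ∑ S ∈ (Finset.range t).powersetCard (m + 1), ∑ x : Walk d k,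
          (∏ j ∈ Finset.range m, ((d : ℝ)⁻¹) ^ (k - j)) * ((d : ℝ)⁻¹) ^ k :=
        Finset.sum_congr rfl fun S hS => Finset.sum_congr rfl fun x _ => hprob S hS x
    -- The `d ^ k` choices of the walk `x` cancel the factor `d ^ (-k)` of the hit with index `0`.
    _ = _ := by
        simp only [Finset.sum_const, Finset.card_powersetCard, Finset.card_range, nsmul_eq_mul,
          Finset.card_univ, Fintype.card_fun, Fintype.card_fin, Nat.cast_pow]
        rw [inv_pow]
        field_simp

/-! ### Groups of walks with a common prefix -/

section IID

variable {W : Type*} [Finite W] [MeasurableSpace W] [MeasurableSingletonClass W]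
variable (ν : Measure W) [IsProbabilityMeasure ν]

lemma dependsOn_of_forall {W : Type*} {F : Set (ℕ → W)} {T : Finset ℕ}
    (h : ∀ x y : ℕ → W, (∀ s ∈ T, x s = y s) → x ∈ F → y ∈ F) :
    DependsOn (· ∈ F) (T : Set ℕ) := fun x y hxy =>
  propext ⟨h x y hxy, h y x fun s hs => (hxy s hs).symm⟩

lemma infinitePi_real_forall_and_exists (n : ℕ) {e : ℕ → ℕ} (he : Set.InjOn e (Set.Iio n))
    {A A' : Set W} (hA : A' ⊆ A) :
    (Measure.infinitePi fun _ : ℕ => ν).real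
        {ρ | (∀ j < n, ρ (e j) ∈ A) ∧ ∃ j < n, ρ (e j) ∈ A'} =
      ν.real A ^ n - (ν.real A - ν.real A') ^ n := by
  have h1 := infinitePi_real_forall_lt_mem ν n he (fun _ => A)
  have h2 := infinitePi_real_forall_lt_mem ν n he (fun _ => A \ A')
  simp only [Finset.prod_const, Finset.card_range] at h1 h2
  rw [measureReal_sdiff hA (Set.toFinite A').measurableSet] at h2
  rw [← h1, ← h2, ← measureReal_sdiff]
  · congr 1
    ext ρ
    simp only [Set.mem_ofPred_eq, Set.mem_sdiff]
    constructor
    · rintro ⟨h, j, hj, hj'⟩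
      exact ⟨h, fun h' => (h' j hj).2 hj'⟩
    · rintro ⟨h, h'⟩
      refine ⟨h, ?_⟩
      by_contra! hc
      exact h' fun j hj => ⟨h j hj, hc j hj⟩
  · exact fun ρ h j hj => (h j hj).1
  · refine measurableSet_of_dependsOn (T := (Finset.range n).image e)
      (dependsOn_of_forall fun x y hxy h j hj => ?_)
    rw [← hxy (e j) (Finset.mem_image_of_mem _ (Finset.mem_range.2 hj))]
    exact h j hj

end IID

/-- Along the times `e`, the walk at time `e 0` is followed by `m` blocks of `C` walks each, the
`b`-th of which contains a walk through the vertex at level `k - b` of the first one. -/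
def groupHit (d k m C : ℕ) (e : ℕ → ℕ) : Set (ℕ → Walk d k) :=
  {ρ | ∀ b < m, ∃ c < C, ρ (e (1 + (b * C + c))) ∈ cyl (ρ (e 0)) (k - b)}

/-- The probability that a group succeeds, given that its walks share the first `k - m` moves. -/
def groupProb (d m C : ℕ) : ℝ := ∏ b ∈ Finset.range m, (1 - (1 - ((d : ℝ)⁻¹) ^ (m - b)) ^ C)

lemma block_index_lt {b c b' C : ℕ} (hb : b < b') (hc : c < C) : b * C + c < b' * C :=
  calc b * C + c < b * C + C := by omega
    _ = (b + 1) * C := by ring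
    _ ≤ b' * C := Nat.mul_le_mul_right _ hb

lemma dependsOn_groupHit {m C : ℕ} {e : ℕ → ℕ} {T : Finset ℕ}
    (he : ∀ j < 1 + m * C, e j ∈ T) :
    DependsOn (· ∈ groupHit d k m C e) (T : Set ℕ) := by
  refine dependsOn_of_forall fun x y hxy h b hb => ?_
  obtain ⟨c, hc, h⟩ := h b hb
  refine ⟨c, hc, ?_⟩
  rwa [← hxy _ (he 0 (by omega)), ← hxy _ (he _ (by have := block_index_lt hb hc; omega))]

/-- Fix the value `r` of the first walk. The blocks are then independent, and a walk with prefix `u`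
passes through the vertex of `r` at level `k - b` with conditional probability `d ^ (-(m - b))`. The
resulting bound does not depend on `r`, so it survives summation over `r`. -/
lemma groupProb_mul_le [NeZero d] {i m C : ℕ} (hk : i + m = k) {e : ℕ → ℕ}
    (he : Set.InjOn e (Set.Iio (1 + m * C))) (u : Walk d k) :
    groupProb d m C * (walkLaw d k).real {ρ | ∀ j < 1 + m * C, ρ (e j) ∈ cyl u i} ≤
      (walkLaw d k).real ({ρ | ∀ j < 1 + m * C, ρ (e j) ∈ cyl u i} ∩ groupHit d k m C e) := by
  classical
  have hd : (d : ℝ) ≠ 0 := Nat.cast_ne_zero.2 (NeZero.ne d)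
  set δ : ℝ := (d : ℝ)⁻¹ with hδ
  have hδ0 : δ ≠ 0 := inv_ne_zero hd
  set F : Walk d k → ℕ → Set (ℕ → Walk d k) := fun r b =>
    {ρ | (∀ c < C, ρ (e (1 + (b * C + c))) ∈ cyl u i) ∧
      ∃ c < C, ρ (e (1 + (b * C + c))) ∈ cyl r (k - b)} with hF
  set D : Walk d k → Set (ℕ → Walk d k) := fun r =>
    {ρ | ρ (e 0) ∈ ({r} : Set (Walk d k))} ∩ ⋂ b ∈ Finset.range m, F r b with hD
  have hinj : ∀ b < m, Set.InjOn (fun c => e (1 + (b * C + c))) (Set.Iio C) := by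
    intro b hb c hc c' hc' h
    have h1 := block_index_lt hb hc
    have h2 := block_index_lt hb hc'
    have := he (show 1 + (b * C + c) < 1 + m * C by omega)
      (show 1 + (b * C + c') < 1 + m * C by omega) h
    omega
  set T : ℕ → Finset ℕ := fun b => (Finset.range C).image fun c => e (1 + (b * C + c)) with hT
  have hFdep : ∀ r b, DependsOn (· ∈ F r b) (T b : Set ℕ) := by
    intro r b
    refine dependsOn_of_forall fun x y hxy h => ?_
    have hxy' : ∀ c < C, x (e (1 + (b * C + c))) = y (e (1 + (b * C + c))) := fun c hc =>
      hxy _ (Finset.mem_image_of_mem _ (Finset.mem_range.2 hc))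
    refine ⟨fun c hc => hxy' c hc ▸ h.1 c hc, ?_⟩
    obtain ⟨c, hc, h2⟩ := h.2
    exact ⟨c, hc, hxy' c hc ▸ h2⟩
  have hTdisj : ((Finset.range m : Finset ℕ) : Set ℕ).PairwiseDisjoint T := by
    intro a ha b hb hab
    simp only [Finset.coe_range, Set.mem_Iio] at ha hb
    rw [Function.onFun, Finset.disjoint_left]
    intro s hs hs'
    obtain ⟨c, hc, rfl⟩ := Finset.mem_image.1 hs
    obtain ⟨c', hc', h⟩ := Finset.mem_image.1 hs'
    rw [Finset.mem_range] at hc hc'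
    have h1 := block_index_lt ha hc
    have h2 := block_index_lt hb hc'
    have := he (show 1 + (b * C + c') < 1 + m * C by omega)
      (show 1 + (a * C + c) < 1 + m * C by omega) h
    rcases lt_or_gt_of_ne hab with h3 | h3
    · have := block_index_lt h3 hc; omega
    · have := block_index_lt h3 hc'; omega
  have hT0 : Disjoint {e 0} ((Finset.range m).biUnion T) := by
    rw [Finset.disjoint_singleton_left, Finset.mem_biUnion]
    rintro ⟨b, hb, h⟩
    obtain ⟨c, hc, h⟩ := Finset.mem_image.1 h
    rw [Finset.mem_range] at hb hc
    have h1 := block_index_lt hb hc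
    have := he (show 1 + (b * C + c) < 1 + m * C by omega) (show 0 < 1 + m * C by omega) h
    omega
  have hdep0 : ∀ r : Walk d k, DependsOn (· ∈ {ρ : ℕ → Walk d k | ρ (e 0) ∈ ({r} : Set (Walk d k))})
      (({e 0} : Finset ℕ) : Set ℕ) := fun r =>
    dependsOn_of_forall fun x y hxy h => by
      have := hxy (e 0) (by simp)
      simpa [← this] using h
  have hdepI : ∀ r : Walk d k, DependsOn (· ∈ ⋂ b ∈ Finset.range m, F r b)
      (((Finset.range m).biUnion T : Finset ℕ) : Set ℕ) := fun r =>
    dependsOn_of_forall fun x y hxy h => by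
      simp only [Set.mem_iInter] at h ⊢
      exact fun b hb => (hFdep r b fun s hs => hxy s (Finset.mem_biUnion.2 ⟨b, hb, hs⟩)).mp (h b hb)
  have hDprob : ∀ r ∈ cyl u i, (walkLaw d k).real (D r) =
      (stepLaw d k).real {r} * ((δ ^ i) ^ (m * C) * groupProb d m C) := by
    intro r hr
    refine (infinitePi_real_inter (stepLaw d k) hT0 (hdep0 r) (hdepI r)).trans ?_
    rw [infinitePi_real_eval,
      infinitePi_real_biInter (stepLaw d k) (Finset.range m) hTdisj (fun b _ => hFdep r b)]
    congr 1
    rw [mul_comm m C, pow_mul, groupProb, ← Finset.card_range m, ← Finset.prod_const,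
      Finset.card_range, ← Finset.prod_mul_distrib]
    refine Finset.prod_congr rfl fun b hb => ?_
    rw [Finset.mem_range] at hb
    have hsub : cyl r (k - b) ⊆ cyl u i := fun x hx =>
      mem_cyl_trans (cyl_anti r (by omega) hx) hr
    refine (infinitePi_real_forall_and_exists (stepLaw d k) C (hinj b hb) hsub).trans ?_
    rw [stepLaw_real_cyl u (by omega), stepLaw_real_cyl r (by omega), ← hδ,
      show k - b = i + (m - b) by omega, pow_add]
    rw [show δ ^ i - δ ^ i * δ ^ (m - b) = δ ^ i * (1 - δ ^ (m - b)) by ring, mul_pow]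
    ring
  have hDmeas : ∀ r, MeasurableSet (D r) := fun r =>
    (measurableSet_of_dependsOn (hdep0 r)).inter (measurableSet_of_dependsOn (hdepI r))
  have hDdisj : (((Set.toFinite (cyl u i)).toFinset : Finset (Walk d k)) :
      Set (Walk d k)).PairwiseDisjoint D := by
    intro r _ r' _ hrr
    refine Set.disjoint_left.2 fun ρ h h' => hrr ?_
    exact (Set.mem_singleton_iff.1 h.1).symm.trans (Set.mem_singleton_iff.1 h'.1)
  have hsub : (⋃ r ∈ (Set.toFinite (cyl u i)).toFinset, D r) ⊆
      {ρ | ∀ j < 1 + m * C, ρ (e j) ∈ cyl u i} ∩ groupHit d k m C e := by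
    intro ρ hρ
    simp only [Set.mem_iUnion, Set.Finite.mem_toFinset] at hρ
    obtain ⟨r, hr, h0, hI⟩ := hρ
    obtain rfl : ρ (e 0) = r := h0
    simp only [Set.mem_iInter, Finset.mem_range] at hI
    refine ⟨fun j hj => ?_, fun b hb => (hI b hb).2⟩
    rcases j with _ | j
    · exact hr
    · have hj' : j < m * C := by omega
      have hC : 0 < C := Nat.pos_of_ne_zero (by rintro rfl; simp at hj')
      have hb : j / C < m := Nat.div_lt_of_lt_mul (by rwa [mul_comm] at hj')
      have := (hI _ hb).1 (j % C) (Nat.mod_lt _ hC)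
      rwa [Nat.div_add_mod', add_comm 1 j] at this
  have hA : (walkLaw d k).real {ρ | ∀ j < 1 + m * C, ρ (e j) ∈ cyl u i} = (δ ^ i) ^ (1 + m * C) := by
    refine (infinitePi_real_forall_lt_mem (stepLaw d k) _ he (fun _ => cyl u i)).trans ?_
    rw [Finset.prod_const, Finset.card_range, stepLaw_real_cyl u (by omega)]
  have hsum : ∑ r ∈ (Set.toFinite (cyl u i)).toFinset, (stepLaw d k).real {r} = δ ^ i := by
    rw [sum_measureReal_singleton, Set.Finite.coe_toFinset, stepLaw_real_cyl u (by omega)]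
  refine le_trans (le_of_eq ?_) (measureReal_mono hsub (measure_ne_top _ _))
  rw [measureReal_biUnion_finset hDdisj fun r _ => hDmeas r,
    Finset.sum_congr rfl fun r hr => hDprob r ((Set.Finite.mem_toFinset _).1 hr),
    ← Finset.sum_mul, hsum, hA]
  ring

/-- Greedy pigeonhole: while at least `card V * N` times remain, some colour has `N` of them, which
are removed as the next group. -/
lemma exists_disjoint_monochromatic {V : Type*} [Fintype V] [DecidableEq V] [Nonempty V] (p : ℕ → V)
    (N G : ℕ) (S : Finset ℕ) (h : (G + Fintype.card V) * N ≤ S.card) :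
    ∃ T : ℕ → Finset ℕ, (∀ g < G, T g ⊆ S ∧ (T g).card = N ∧ ∃ v, ∀ s ∈ T g, p s = v) ∧
      ((Finset.range G : Finset ℕ) : Set ℕ).PairwiseDisjoint T := by
  induction G generalizing S with
  | zero => exact ⟨fun _ => ∅, by simp, by simp⟩
  | succ G ih =>
    obtain ⟨v, -, hv⟩ := Finset.exists_le_card_fiber_of_mul_le_card_of_maps_to
      (s := S) (t := Finset.univ) (f := p) (n := N) (by simp) Finset.univ_nonempty (by
        rw [Finset.card_univ]; refine le_trans ?_ h; gcongr; omega)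
    obtain ⟨U, hU, hUc⟩ := Finset.exists_subset_card_eq hv
    have hUS : U ⊆ S := hU.trans (Finset.filter_subset _ _)
    obtain ⟨T, hT, hTd⟩ := ih (S \ U) (by
      rw [Finset.card_sdiff_of_subset hUS, hUc]
      have : (G + 1 + Fintype.card V) * N = (G + Fintype.card V) * N + N := by ring
      omega)
    have hdisj : ∀ g < G, Disjoint U (T g) := fun g hg =>
      Finset.disjoint_sdiff.mono_right (hT g hg).1
    refine ⟨fun g => if g < G then T g else U, fun g hg => ?_, fun a ha b hb hab => ?_⟩
    · dsimp only
      split_ifs with h1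
      · exact ⟨(hT g h1).1.trans Finset.sdiff_subset, (hT g h1).2⟩
      · exact ⟨hUS, hUc, v, fun s hs => (Finset.mem_filter.1 (hU hs)).2⟩
    · simp only [Finset.coe_range, Set.mem_Iio] at ha hb
      simp only [Function.onFun]
      split_ifs with h1 h2 h2
      · exact hTd (by simpa using h1) (by simpa using h2) hab
      · exact (hdisj a h1).symm
      · exact hdisj b h2
      · omega

lemma cluster_congr {ρ ρ' : ℕ → Walk d k} {t : ℕ} (h : ∀ s < t, ρ s = ρ' s) :
    cluster ρ t = cluster ρ' t := by
  induction t with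
  | zero => rfl
  | succ t ih =>
    rw [cluster, cluster, ih fun s hs => h s (by omega), h t (by omega)]

lemma occupiedBelow_of_groupHit {i m C n : ℕ} (hk : i + m = k) {T : Finset ℕ}
    (hTn : T ⊆ Finset.range n) (hT : T.card = 1 + m * C) {ρ : ℕ → Walk d k}
    (h : ρ ∈ groupHit d k m C (enum T)) : OccupiedBelow ρ n (ρ (enum T 0)) i := by
  choose! c hc h using h
  have hidx : ∀ b < m, 1 + (b * C + c b) < T.card := fun b hb => by
    have := block_index_lt hb (hc b hb); omega
  have h0 : ∀ j < T.card, enum T j < n := fun j hj => Finset.mem_range.1 (hTn (enum_mem hj))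
  have := occupiedBelow_of_hits (fun b => enum T (1 + (b * C + c b)))
    (occupiedBelow_height ρ (enum T 0)) m (by omega)
    (fun b hb => enum_lt_enum (by omega) (hidx b hb))
    (fun b b' hb hb' => enum_lt_enum (by have := block_index_lt hb (hc b (by omega)); omega)
      (hidx b' hb'))
    h (h0 0 (by omega)) (fun b hb => h0 _ (hidx b hb))
  rwa [show k - m = i by omega] at this

lemma one_sub_groupProb_nonneg [NeZero d] (m C : ℕ) : 0 ≤ 1 - groupProb d m C := by
  have hd : (1 : ℝ) ≤ d := Nat.one_le_cast.2 (NeZero.one_le)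
  rw [sub_nonneg]
  have h : ∀ b, 0 ≤ 1 - ((d : ℝ)⁻¹) ^ (m - b) := fun b =>
    sub_nonneg.2 (pow_le_one₀ (by positivity) (inv_le_one_of_one_le₀ hd))
  refine Finset.prod_le_one (fun b _ => ?_) (fun b _ => ?_)
  · exact sub_nonneg.2 (pow_le_one₀ (h b) (sub_le_self _ (by positivity)))
  · exact sub_le_self _ (pow_nonneg (h b) _)

/-- The first `i` moves of a walk. -/
def takePrefix {i : ℕ} (hi : i ≤ k) (r : Walk d k) : Fin i → Fin d := fun j => r (Fin.castLE hi j)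

lemma takePrefix_eq_iff {i : ℕ} (hi : i ≤ k) (r x : Walk d k) :
    takePrefix hi x = takePrefix hi r ↔ x ∈ cyl r i := by
  constructor
  · exact fun h j hj => congrFun h ⟨j, hj⟩
  · exact fun h => funext fun j => h _ j.2

/-- The prefixes of length `i` are frozen first, so that the groups are deterministic sets of times.
Given the prefixes, the groups depend on disjoint sets of walks, and all `d ^ i` of them must fail.
-/
lemma walkLaw_not_occupiedBelow [NeZero d] {i m : ℕ} (hk : i + m = k) (C : ℕ) :
    (walkLaw d k).real {ρ | ¬ ∃ r, OccupiedBelow ρ (2 * d ^ i * (1 + m * C)) r i} ≤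
      (1 - groupProb d m C) ^ (d ^ i) := by
  classical
  have hi : i ≤ k := by omega
  set n := 2 * d ^ i * (1 + m * C) with hn
  set φ : (ℕ → Walk d k) → (Fin n → Fin i → Fin d) := fun ρ s => takePrefix hi (ρ s) with hφ
  have hfib : ∀ ρ₀, φ ⁻¹' {φ ρ₀} = {ρ | ∀ s ∈ Finset.range n, ρ s ∈ cyl (ρ₀ s) i} := by
    intro ρ₀
    ext ρ
    simp only [Set.mem_preimage, Set.mem_singleton_iff, Set.mem_ofPred_eq, Finset.mem_range]
    constructor
    · exact fun h s hs => (takePrefix_eq_iff hi _ _).1 (congrFun h ⟨s, hs⟩)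
    · exact fun h => funext fun s => (takePrefix_eq_iff hi _ _).2 (h s s.2)
  have hboxdep : ∀ (ρ₀ : ℕ → Walk d k) (S : Finset ℕ),
      DependsOn (· ∈ {ρ : ℕ → Walk d k | ∀ s ∈ S, ρ s ∈ cyl (ρ₀ s) i}) (S : Set ℕ) := fun ρ₀ S =>
    dependsOn_of_forall fun x y hxy h s hs => hxy s hs ▸ h s hs
  refine measureReal_le_of_forall_fiber _ φ (fun v => ?_) _ _ fun ρ₀ => ?_
  · by_cases hv : ∃ ρ₀, φ ρ₀ = v
    · obtain ⟨ρ₀, rfl⟩ := hv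
      rw [hfib]
      exact measurableSet_of_dependsOn (hboxdep ρ₀ _)
    · convert MeasurableSet.empty
      exact Set.eq_empty_of_forall_notMem fun ρ hρ => hv ⟨ρ, hρ⟩
  rw [hfib]
  obtain ⟨T, hT, hTd⟩ := exists_disjoint_monochromatic (fun s => takePrefix hi (ρ₀ s)) (1 + m * C)
    (d ^ i) (Finset.range n) (by
      simp only [Fintype.card_fun, Fintype.card_fin, Finset.card_range, hn]
      exact le_of_eq (by ring))
  set G := Finset.range (d ^ i) with hG
  set R := Finset.range n \ G.biUnion T with hR
  set A : Finset ℕ → Set (ℕ → Walk d k) := fun S => {ρ | ∀ s ∈ S, ρ s ∈ cyl (ρ₀ s) i} with hA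
  set H : ℕ → Set (ℕ → Walk d k) := fun g => groupHit d k m C (enum (T g)) with hH
  have hHdep : ∀ g ∈ G, DependsOn (· ∈ H g) (T g : Set ℕ) := fun g hg =>
    dependsOn_groupHit fun j hj =>
      enum_mem (by rw [(hT g (Finset.mem_range.1 hg)).2.1]; exact hj)
  have hAHdep : ∀ g ∈ G, DependsOn (· ∈ A (T g) \ H g) (T g : Set ℕ) := fun g hg =>
    dependsOn_of_forall fun x y hxy h =>
      ⟨(hboxdep ρ₀ (T g) hxy).mp h.1, fun h' => h.2 ((hHdep g hg hxy).mpr h')⟩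
  have hRdisj : Disjoint R (G.biUnion T) := Finset.sdiff_disjoint
  have hIdep : ∀ F : ℕ → Set (ℕ → Walk d k), (∀ g ∈ G, DependsOn (· ∈ F g) (T g : Set ℕ)) →
      DependsOn (· ∈ ⋂ g ∈ G, F g) ((G.biUnion T : Finset ℕ) : Set ℕ) := fun F hF =>
    dependsOn_of_forall fun x y hxy h => by
      simp only [Set.mem_iInter] at h ⊢
      exact fun g hg => (hF g hg fun s hs => hxy s (Finset.mem_biUnion.2 ⟨g, hg, hs⟩)).mp (h g hg)
  have hprod : ∀ F : ℕ → Set (ℕ → Walk d k), (∀ g ∈ G, DependsOn (· ∈ F g) (T g : Set ℕ)) →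
      (walkLaw d k).real (A R ∩ ⋂ g ∈ G, F g) =
        (walkLaw d k).real (A R) * ∏ g ∈ G, (walkLaw d k).real (F g) := fun F hF =>
    (infinitePi_real_inter (stepLaw d k) hRdisj (hboxdep ρ₀ R) (hIdep F hF)).trans
      (congrArg _ (infinitePi_real_biInter (stepLaw d k) G hTd hF))
  have hgroup : ∀ g ∈ G, (walkLaw d k).real (A (T g) \ H g) ≤
      (1 - groupProb d m C) * (walkLaw d k).real (A (T g)) := by
    intro g hg
    obtain ⟨-, hc, v, hv⟩ := hT g (Finset.mem_range.1 hg)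
    have hmem0 : enum (T g) 0 ∈ T g := enum_mem (by omega)
    -- All prefixes prescribed on `T g` coincide, so the conditioning there is on a single cylinder.
    have hAeq : A (T g) =
        {ρ | ∀ j < 1 + m * C, ρ (enum (T g) j) ∈ cyl (ρ₀ (enum (T g) 0)) i} := by
      have hcyl : ∀ s ∈ T g, ∀ s' ∈ T g, ρ₀ s ∈ cyl (ρ₀ s') i := fun s hs s' hs' =>
        (takePrefix_eq_iff hi _ _).1 ((hv s hs).trans (hv s' hs').symm)
      have himg : (Finset.range (1 + m * C)).image (enum (T g)) = T g := by
        refine Finset.eq_of_subset_of_card_le (fun s hs => ?_) ?_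
        · obtain ⟨j, hj, rfl⟩ := Finset.mem_image.1 hs
          exact enum_mem (by rw [hc]; exact Finset.mem_range.1 hj)
        · rw [Finset.card_image_of_injOn, Finset.card_range, hc]
          rw [Finset.coe_range, ← hc]
          exact enum_injOn _
      ext ρ
      constructor
      · intro h j hj
        have hj' : enum (T g) j ∈ T g := enum_mem (by omega)
        exact mem_cyl_trans (h _ hj') (hcyl _ hj' _ hmem0)
      · intro h s hs
        have hs' := hs
        rw [← himg] at hs'
        obtain ⟨j, hj, rfl⟩ := Finset.mem_image.1 hs'
        exact mem_cyl_trans (h j (Finset.mem_range.1 hj)) (hcyl _ hmem0 _ hs)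
    have h1 := groupProb_mul_le (C := C) hk (hc ▸ enum_injOn (T g)) (ρ₀ (enum (T g) 0))
    rw [← hAeq] at h1
    have h2 := measureReal_inter_add_sdiff (μ := walkLaw d k) (s := A (T g))
      (measurableSet_of_dependsOn (hHdep g hg))
    linarith
  have hAsplit : A (Finset.range n) = A R ∩ ⋂ g ∈ G, A (T g) := by
    ext ρ
    simp only [Set.mem_inter_iff, Set.mem_iInter]
    constructor
    · exact fun h => ⟨fun s hs => h s (Finset.sdiff_subset hs), fun g hg s hs =>
        h s ((hT g (Finset.mem_range.1 hg)).1 hs)⟩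
    · rintro ⟨h1, h2⟩ s hs
      by_cases hsU : s ∈ G.biUnion T
      · obtain ⟨g, hg, hs'⟩ := Finset.mem_biUnion.1 hsU
        exact h2 g hg s hs'
      · exact h1 s (Finset.mem_sdiff.2 ⟨hs, hsU⟩)
  have hsub : A (Finset.range n) ∩ {ρ | ¬ ∃ r, OccupiedBelow ρ n r i} ⊆
      A R ∩ ⋂ g ∈ G, (A (T g) \ H g) := by
    rintro ρ ⟨h1, h2⟩
    rw [hAsplit] at h1
    simp only [Set.mem_inter_iff, Set.mem_iInter] at h1 ⊢
    refine ⟨h1.1, fun g hg => ⟨h1.2 g hg, fun h3 => h2 ?_⟩⟩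
    have := hT g (Finset.mem_range.1 hg)
    exact ⟨_, occupiedBelow_of_groupHit hk this.1 this.2.1 h3⟩
  calc (walkLaw d k).real (A (Finset.range n) ∩ {ρ | ¬ ∃ r, OccupiedBelow ρ n r i})
      ≤ (walkLaw d k).real (A R ∩ ⋂ g ∈ G, (A (T g) \ H g)) :=
        measureReal_mono hsub (measure_ne_top _ _)
    _ = (walkLaw d k).real (A R) * ∏ g ∈ G, (walkLaw d k).real (A (T g) \ H g) := hprod _ hAHdep
    _ ≤ (walkLaw d k).real (A R) *
          ∏ g ∈ G, (1 - groupProb d m C) * (walkLaw d k).real (A (T g)) := by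
        refine mul_le_mul_of_nonneg_left (Finset.prod_le_prod (fun _ _ => measureReal_nonneg) hgroup)
          measureReal_nonneg
    _ = (1 - groupProb d m C) ^ (d ^ i) *
          ((walkLaw d k).real (A R) * ∏ g ∈ G, (walkLaw d k).real (A (T g))) := by
        rw [Finset.prod_mul_distrib, Finset.prod_const, hG, Finset.card_range]
        ring
    _ = (1 - groupProb d m C) ^ (d ^ i) * (walkLaw d k).real (A (Finset.range n)) := by
        rw [← hprod _ fun g _ => hboxdep ρ₀ (T g), ← hAsplit]

/-! ### Climbing from level `i` to the root -/

/-- For some `b < i`, no walk at the times in `[N - 2 M d ^ (i - b), N - M d ^ (i - b))` passes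
through the vertex of `r` at level `i - b`. -/
def climbFail (d k i M N : ℕ) (r : Walk d k) : Set (ℕ → Walk d k) :=
  {ρ | ∃ b < i, ∀ s ∈ Finset.Ico (N - 2 * (M * d ^ (i - b))) (N - M * d ^ (i - b)),
    ρ s ∈ (cyl r (i - b))ᶜ}

lemma pow_one_sub_inv_le {n M : ℕ} (x : ℝ) (hx0 : 0 ≤ 1 - x) (h : x * n = M) :
    (1 - x) ^ n ≤ Real.exp (-M) := by
  calc (1 - x) ^ n ≤ (Real.exp (-x)) ^ n := pow_le_pow_left₀ hx0 (Real.one_sub_le_exp_neg x) n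
    _ = Real.exp (-M) := by rw [← Real.exp_nat_mul, ← h]; ring_nf

lemma walkLaw_climbFail [NeZero d] {i M N : ℕ} (hi : i ≤ k) (hN : 2 * (M * d ^ i) ≤ N) (r : Walk d k) :
    (walkLaw d k).real (climbFail d k i M N r) ≤ i * Real.exp (-M) := by
  have hd : (1 : ℝ) ≤ d := Nat.one_le_cast.2 (NeZero.one_le)
  have hsub : climbFail d k i M N r ⊆ ⋃ b ∈ Finset.range i, {ρ : ℕ → Walk d k |
      ∀ s ∈ Finset.Ico (N - 2 * (M * d ^ (i - b))) (N - M * d ^ (i - b)),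
        ρ s ∈ (cyl r (i - b))ᶜ} := by
    rintro ρ ⟨b, hb, h⟩
    simp only [Set.mem_iUnion]
    exact ⟨b, Finset.mem_range.2 hb, h⟩
  have hblock : ∀ b ∈ Finset.range i, (walkLaw d k).real {ρ : ℕ → Walk d k |
      ∀ s ∈ Finset.Ico (N - 2 * (M * d ^ (i - b))) (N - M * d ^ (i - b)),
        ρ s ∈ (cyl r (i - b))ᶜ} ≤ Real.exp (-M) := by
    intro b _
    have hle : M * d ^ (i - b) ≤ M * d ^ i :=
      Nat.mul_le_mul_left _ (Nat.pow_le_pow_right (NeZero.pos d) (Nat.sub_le i b))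
    refine (infinitePi_real_forall_mem (stepLaw d k) _ fun _ => (cyl r (i - b))ᶜ).trans_le ?_
    rw [Finset.prod_const, Nat.card_Ico,
      probReal_compl_eq_one_sub (Set.toFinite _).measurableSet, stepLaw_real_cyl r (by omega),
      show N - M * d ^ (i - b) - (N - 2 * (M * d ^ (i - b))) = M * d ^ (i - b) by omega]
    refine pow_one_sub_inv_le _ ?_ ?_
    · exact sub_nonneg.2 (pow_le_one₀ (by positivity) (inv_le_one_of_one_le₀ hd))
    · push_cast
      rw [inv_pow]
      field_simp
  calc (walkLaw d k).real (climbFail d k i M N r) ≤ _ := measureReal_mono hsub (measure_ne_top _ _)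
    _ ≤ _ := measureReal_biUnion_finset_le _ _
    _ ≤ ∑ _b ∈ Finset.range i, Real.exp (-M) := Finset.sum_le_sum hblock
    _ = i * Real.exp (-M) := by simp

/-- The windows are measured backwards from the final time and halve at least at each level, so one
hit in each gives hits in the right order. -/
lemma finishTime_le_of_notMem_climbFail (hd : 2 ≤ d) {i M n : ℕ} {r : Walk d k} {ρ : ℕ → Walk d k}
    (hocc : OccupiedBelow ρ n r i) (h : ρ ∉ climbFail d k i M (n + 2 * (M * d ^ i)) r) :
    finishTime ρ ≤ n + 2 * (M * d ^ i) := by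
  have h' : ∀ b < i, ∃ s, n + 2 * (M * d ^ i) - 2 * (M * d ^ (i - b)) ≤ s ∧
      s < n + 2 * (M * d ^ i) - M * d ^ (i - b) ∧ ρ s ∈ cyl r (i - b) := by
    intro b hb
    by_contra! hc
    exact h ⟨b, hb, fun s hs => hc s (Finset.mem_Ico.1 hs).1 (Finset.mem_Ico.1 hs).2⟩
  choose! a ha1 ha2 ha3 using h'
  have hle : ∀ b, M * d ^ (i - b) ≤ M * d ^ i := fun b =>
    Nat.mul_le_mul_left _ (Nat.pow_le_pow_right (by omega) (Nat.sub_le i b))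
  have hmono : ∀ b c, b < c → c < i → a b < a c := by
    intro b c hbc hc
    -- This is where `2 ≤ d` makes the window of `b` end before that of `c` begins.
    have h1 : 2 * (M * d ^ (i - c)) ≤ M * d ^ (i - b) :=
      calc 2 * (M * d ^ (i - c)) ≤ d * (M * d ^ (i - c)) := Nat.mul_le_mul_right _ hd
        _ = M * d ^ (i - c + 1) := by ring
        _ ≤ M * d ^ (i - b) :=
          Nat.mul_le_mul_left _ (Nat.pow_le_pow_right (by omega) (by omega))
    have h2 := ha2 b (by omega)
    have h3 := ha1 c hc
    omega
  have := occupiedBelow_of_hits a hocc i le_rfl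
    (fun b hb => by have := ha1 b hb; have := hle b; omega) hmono ha3
    (t' := n + 2 * (M * d ^ i)) (by omega) (fun b hb => by have := ha2 b hb; omega)
  rw [Nat.sub_self] at this
  exact this.finishTime_le

/-- Once a vertex at level at most `i` is occupied, the root is occupied soon after. -/
lemma walkLaw_lt_finishTime_le (hd : 2 ≤ d) {i : ℕ} (hi : i ≤ k) (n M : ℕ) :
    (walkLaw d k).real {ρ | n + 2 * (M * d ^ i) < finishTime ρ} ≤
      (walkLaw d k).real {ρ | ¬ ∃ r, OccupiedBelow ρ n r i} + i * Real.exp (-M) := by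
  have : NeZero d := ⟨by omega⟩
  -- The path to climb is selected from the first `n` walks alone, hence independently of the
  -- windows, which lie in `[n, N)`. If no path qualifies the value is arbitrary.
  set φ : (ℕ → Walk d k) → Walk d k := fun ρ =>
    Classical.epsilon fun r => OccupiedBelow ρ n r i with hφ
  set N := n + 2 * (M * d ^ i) with hN
  have hφdep : ∀ r, DependsOn (· ∈ φ ⁻¹' {r}) ((Finset.range n : Finset ℕ) : Set ℕ) := by
    refine fun r => dependsOn_of_forall fun x y hxy h => ?_
    have hxy' : φ x = φ y := by
      simp only [hφ, OccupiedBelow, cluster_congr fun s hs => hxy s (Finset.mem_range.2 hs)]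
    exact hxy'.symm.trans h
  have hcdep : ∀ r, DependsOn (· ∈ climbFail d k i M N r) ((Finset.Ico n N : Finset ℕ) : Set ℕ) := by
    refine fun r => dependsOn_of_forall fun x y hxy ⟨b, hb, h⟩ => ⟨b, hb, fun s hs => ?_⟩
    have hle : M * d ^ (i - b) ≤ M * d ^ i :=
      Nat.mul_le_mul_left _ (Nat.pow_le_pow_right (by omega) (Nat.sub_le i b))
    rw [← hxy s (by rw [Finset.mem_Ico] at hs ⊢; omega)]
    exact h s hs
  have hB : (walkLaw d k).real {ρ | ρ ∈ climbFail d k i M N (φ ρ)} ≤ i * Real.exp (-M) := by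
    refine measureReal_le_of_forall_fiber _ φ (fun v => measurableSet_of_dependsOn (hφdep v)) _ _
      fun ρ₀ => ?_
    have h1 : φ ⁻¹' {φ ρ₀} ∩ {ρ | ρ ∈ climbFail d k i M N (φ ρ)} =
        φ ⁻¹' {φ ρ₀} ∩ climbFail d k i M N (φ ρ₀) := by
      ext ρ
      refine and_congr_right fun h => ?_
      have h : φ ρ = φ ρ₀ := h
      simp only [Set.mem_ofPred_eq, h]
    rw [h1]
    refine (infinitePi_real_inter (stepLaw d k) (T := Finset.range n) (T' := Finset.Ico n N) ?_
      (hφdep _) (hcdep _)).trans_le ?_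
    · rw [Finset.disjoint_left]
      intro s hs hs'
      rw [Finset.mem_range] at hs
      rw [Finset.mem_Ico] at hs'
      omega
    · rw [mul_comm]
      exact mul_le_mul_of_nonneg_right (walkLaw_climbFail hi (by omega) _) measureReal_nonneg
  have hsub : {ρ : ℕ → Walk d k | N < finishTime ρ} ⊆
      {ρ | ¬ ∃ r, OccupiedBelow ρ n r i} ∪ {ρ | ρ ∈ climbFail d k i M N (φ ρ)} := by
    intro ρ hρ
    by_cases hex : ∃ r, OccupiedBelow ρ n r i
    · right
      by_contra hc
      exact absurd hρ (not_lt.2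
        (finishTime_le_of_notMem_climbFail hd (Classical.epsilon_spec hex) hc))
    · exact Or.inl hex
  calc _ ≤ _ := measureReal_mono hsub (measure_ne_top _ _)
    _ ≤ _ := measureReal_union_le _ _
    _ ≤ _ := by gcongr

/-! ### Late finish: numerical estimates -/

lemma mul_exp_neg_le_one_sub_pow {p : ℝ} (hp1 : p ≤ 1) (C : ℕ) :
    C * p * Real.exp (-(C * p)) ≤ 1 - (1 - p) ^ C := by
  have h1 : (1 - p) ^ C ≤ Real.exp (-(C * p)) := by
    calc (1 - p) ^ C ≤ (Real.exp (-p)) ^ C :=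
          pow_le_pow_left₀ (sub_nonneg.2 hp1) (Real.one_sub_le_exp_neg p) C
      _ = Real.exp (-(C * p)) := by rw [← Real.exp_nat_mul]; ring_nf
  have h2 := Real.add_one_le_exp (C * p : ℝ)
  have h3 : Real.exp (C * p) * Real.exp (-(C * p)) = 1 := by rw [← Real.exp_add]; simp
  have h4 := mul_le_mul_of_nonneg_right h2 (Real.exp_pos (-(C * p))).le
  rw [h3] at h4
  linarith

/-- Each factor is at least `C δ ^ j exp(-C δ ^ j)`, where `δ = 1 / d`. Since `δ ≤ 1/2`, the sum of
`δ ^ j` over `1 ≤ j ≤ m` is at most `1 - δ ^ m`, a form that closes the induction. -/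
lemma le_groupProb (hd : 2 ≤ d) (m C : ℕ) :
    (C : ℝ) ^ m * ((d : ℝ)⁻¹) ^ (∑ j ∈ Finset.range (m + 1), j) *
      Real.exp (-(C * (1 - ((d : ℝ)⁻¹) ^ m))) ≤ groupProb d m C := by
  have hd' : (2 : ℝ) ≤ d := by exact_mod_cast hd
  set δ : ℝ := (d : ℝ)⁻¹ with hδ
  have hδ0 : 0 ≤ δ := by positivity
  have hδ2 : 2 * δ ≤ 1 := by
    rw [hδ, ← div_eq_mul_inv, div_le_one (by linarith)]
    exact hd'
  induction m with
  | zero => simp [groupProb]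
  | succ m ih =>
    have hstep : groupProb d (m + 1) C = groupProb d m C * (1 - (1 - δ ^ (m + 1)) ^ C) := by
      simp only [groupProb]
      rw [Finset.prod_range_succ']
      simp [hδ]
    rw [hstep]
    have h1 := mul_exp_neg_le_one_sub_pow (pow_le_one₀ hδ0 (by linarith) : δ ^ (m + 1) ≤ 1) C
    have hexp : Real.exp (-(C * (1 - δ ^ (m + 1)))) ≤
        Real.exp (-(C * (1 - δ ^ m))) * Real.exp (-(C * δ ^ (m + 1))) := by
      rw [← Real.exp_add, Real.exp_le_exp]
      have h2 : 2 * δ ^ (m + 1) ≤ δ ^ m := by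
        rw [pow_succ]
        nlinarith [pow_nonneg hδ0 m]
      nlinarith [Nat.cast_nonneg (α := ℝ) C]
    rw [Finset.sum_range_succ, pow_succ (C : ℝ), pow_add]
    calc (C : ℝ) ^ m * C * (δ ^ (∑ j ∈ Finset.range (m + 1), j) * δ ^ (m + 1)) *
          Real.exp (-(C * (1 - δ ^ (m + 1))))
        ≤ (C : ℝ) ^ m * C * (δ ^ (∑ j ∈ Finset.range (m + 1), j) * δ ^ (m + 1)) *
          (Real.exp (-(C * (1 - δ ^ m))) * Real.exp (-(C * δ ^ (m + 1)))) := by gcongr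
      _ = ((C : ℝ) ^ m * δ ^ (∑ j ∈ Finset.range (m + 1), j) * Real.exp (-(C * (1 - δ ^ m)))) *
          (C * δ ^ (m + 1) * Real.exp (-(C * δ ^ (m + 1)))) := by ring
      _ ≤ _ := mul_le_mul ih h1 (by positivity) (le_trans (by positivity) ih)

lemma le_groupProb_mul_pow (hd : 2 ≤ d) {i m : ℕ} (hk : i + m = k) (hm : m * m ≤ 2 * k) :
    m * Real.exp (-(d : ℝ) ^ 3) ≤ groupProb d m (d ^ 3) * (d : ℝ) ^ i := by
  have hd' : (2 : ℝ) ≤ d := by exact_mod_cast hd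
  have hd0 : (d : ℝ) ≠ 0 := by linarith
  -- With `C = d ^ 3`, the exponent `3m - m(m + 1)/2 + (k - m)` is still at least `m`, because `m ^
  -- 2 ≤ 2k`.
  have hS : (∑ j ∈ Finset.range (m + 1), j) + m ≤ 3 * m + i := by
    have := Finset.sum_range_id_mul_two (m + 1)
    simp only [Nat.add_sub_cancel] at this
    have h2 : (m + 1) * m = m * m + m := by ring
    omega
  obtain ⟨w, hw⟩ := Nat.exists_eq_add_of_le hS
  have h1 := le_groupProb hd m (d ^ 3)
  have hexp : Real.exp (-(d : ℝ) ^ 3) ≤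
      Real.exp (-(((d ^ 3 : ℕ) : ℝ) * (1 - ((d : ℝ)⁻¹) ^ m))) := by
    rw [Real.exp_le_exp]
    push_cast
    have : 0 ≤ (d : ℝ) ^ 3 * ((d : ℝ)⁻¹) ^ m := by positivity
    linarith
  have hmd : (m : ℝ) ≤ (d : ℝ) ^ m := by
    exact_mod_cast (Nat.lt_pow_self (by omega : 1 < d)).le
  have hone : (1 : ℝ) ≤ (d : ℝ) ^ w := one_le_pow₀ (by linarith)
  have hpow : (((d ^ 3 : ℕ) : ℝ)) ^ m * ((d : ℝ)⁻¹) ^ (∑ j ∈ Finset.range (m + 1), j) * (d : ℝ) ^ i =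
      (d : ℝ) ^ m * (d : ℝ) ^ w := by
    have e1 : (d : ℝ) ^ (3 * m) * (d : ℝ) ^ i =
        (d : ℝ) ^ (∑ j ∈ Finset.range (m + 1), j) * ((d : ℝ) ^ m * (d : ℝ) ^ w) := by
      rw [← pow_add, ← pow_add, ← pow_add, hw, add_assoc]
    push_cast
    rw [← pow_mul, inv_pow]
    field_simp
    linarith
  calc m * Real.exp (-(d : ℝ) ^ 3)
      ≤ ((d : ℝ) ^ m * (d : ℝ) ^ w) *
        Real.exp (-(((d ^ 3 : ℕ) : ℝ) * (1 - ((d : ℝ)⁻¹) ^ m))) := by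
        refine mul_le_mul (hmd.trans (le_mul_of_one_le_right (by positivity) hone)) hexp
          (Real.exp_pos _).le (by positivity)
    _ = (((d ^ 3 : ℕ) : ℝ) ^ m * ((d : ℝ)⁻¹) ^ (∑ j ∈ Finset.range (m + 1), j) *
        Real.exp (-(((d ^ 3 : ℕ) : ℝ) * (1 - ((d : ℝ)⁻¹) ^ m)))) * (d : ℝ) ^ i := by
        rw [← hpow]; ring
    _ ≤ _ := by gcongr

/-- The bound for the probability of a late finish, in terms of `m = ⌊√(2k)⌋`. -/
def lateBound (d m : ℕ) : ℝ :=
  Real.exp (-(m * Real.exp (-(d : ℝ) ^ 3))) + ((m : ℝ) + 1) ^ 2 * Real.exp (-m)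

lemma tendsto_lateBound (d : ℕ) : Tendsto (lateBound d) atTop (𝓝 0) := by
  have hm : Tendsto (fun m : ℕ => (m : ℝ)) atTop atTop := tendsto_natCast_atTop_atTop
  have h1 : Tendsto (fun m : ℕ => Real.exp (-(m * Real.exp (-(d : ℝ) ^ 3)))) atTop (𝓝 0) :=
    Real.tendsto_exp_neg_atTop_nhds_zero.comp (hm.atTop_mul_const (Real.exp_pos _))
  have h2 : Tendsto (fun m : ℕ => ((m : ℝ) + 1) ^ 2 * Real.exp (-m)) atTop (𝓝 0) := by
    have h3 := ((Real.tendsto_pow_mul_exp_neg_atTop_nhds_zero 2).comp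
      (tendsto_atTop_add_const_right _ 1 hm)).mul_const (Real.exp 1)
    rw [zero_mul] at h3
    refine h3.congr fun m => ?_
    simp only [Function.comp]
    rw [mul_assoc, ← Real.exp_add]
    ring_nf
  have h3 := h1.add h2
  rw [add_zero] at h3
  exact h3

lemma walkLaw_late (hd : 2 ≤ d) (hk : 2 ≤ k) :
    (walkLaw d k).real {ρ | 12 * (d : ℝ) ^ 4 * Tf d k < finishTime ρ} ≤
      lateBound d (Nat.sqrt (2 * k)) := by
  have : NeZero d := ⟨by omega⟩
  have hd' : (2 : ℝ) ≤ d := by exact_mod_cast hd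
  set m := Nat.sqrt (2 * k) with hm
  have hmm : m * m ≤ 2 * k := Nat.sqrt_le _
  have hmm' : 2 * k < (m + 1) * (m + 1) := Nat.lt_succ_sqrt _
  have hmk : m ≤ k := by nlinarith
  have hm1 : 1 ≤ m := by nlinarith
  set i := k - m with hi
  have hik : i + m = k := by omega
  set n := 2 * d ^ i * (1 + m * d ^ 3) with hn
  have hmy : (m : ℝ) ≤ √(2 * (k : ℝ)) := by
    apply Real.le_sqrt_of_sq_le
    rw [sq]; exact_mod_cast hmm
  have hym : √(2 * (k : ℝ)) ≤ m + 1 := by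
    rw [Real.sqrt_le_left (by positivity), sq]
    exact_mod_cast hmm'.le
  have hdi : (d : ℝ) ^ i ≤ d * (d : ℝ) ^ ((k : ℝ) - √(2 * (k : ℝ))) := by
    have hd0 : (0 : ℝ) < d := by linarith
    rw [← Real.rpow_natCast, show (d : ℝ) * (d : ℝ) ^ ((k : ℝ) - √(2 * (k : ℝ))) =
      (d : ℝ) ^ (1 + ((k : ℝ) - √(2 * (k : ℝ)))) by rw [Real.rpow_add hd0, Real.rpow_one]]
    apply Real.rpow_le_rpow_of_exponent_le (by linarith)
    rw [hi, Nat.cast_sub hmk]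
    linarith
  have hm2 : (m : ℝ) ≤ 2 * √(k : ℝ) := by
    refine hmy.trans ?_
    rw [Real.sqrt_mul (by norm_num)]
    gcongr
    rw [Real.sqrt_le_left (by norm_num)]
    norm_num
  -- The constant collects `2 · 3 · 2` and `d · d ^ 3`: one `d` is lost in rounding `√(2k)` down to
  -- `m`, and `d ^ 3` is the block length.
  have htime : ((n + 2 * (m * d ^ i) : ℕ) : ℝ) ≤ 12 * (d : ℝ) ^ 4 * Tf d k := by
    have hm1' : (1 : ℝ) ≤ m := by exact_mod_cast hm1
    have hd3 : (1 : ℝ) ≤ (d : ℝ) ^ 3 := one_le_pow₀ (by linarith)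
    have h1 : (1 : ℝ) + m * (d : ℝ) ^ 3 + m ≤ 3 * (m * (d : ℝ) ^ 3) := by nlinarith
    calc ((n + 2 * (m * d ^ i) : ℕ) : ℝ)
        = 2 * (d : ℝ) ^ i * (1 + m * (d : ℝ) ^ 3 + m) := by rw [hn]; push_cast; ring
      _ ≤ 2 * (d * (d : ℝ) ^ ((k : ℝ) - √(2 * (k : ℝ)))) * (3 * ((2 * √(k : ℝ)) * (d : ℝ) ^ 3)) := by
          gcongr
          exact h1.trans (by gcongr)
      _ = 12 * (d : ℝ) ^ 4 * Tf d k := by rw [Tf]; ring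
  have hsub : {ρ : ℕ → Walk d k | 12 * (d : ℝ) ^ 4 * Tf d k < finishTime ρ} ⊆
      {ρ | n + 2 * (m * d ^ i) < finishTime ρ} := fun ρ h => by
    have h : 12 * (d : ℝ) ^ 4 * Tf d k < finishTime ρ := h
    exact_mod_cast htime.trans_lt h
  refine (measureReal_mono hsub (measure_ne_top _ _)).trans
    ((walkLaw_lt_finishTime_le hd (by omega) n m).trans (add_le_add ?_ ?_))
  · refine (walkLaw_not_occupiedBelow hik (d ^ 3)).trans ?_
    calc (1 - groupProb d m (d ^ 3)) ^ d ^ i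
        ≤ (Real.exp (-groupProb d m (d ^ 3))) ^ d ^ i :=
          pow_le_pow_left₀ (one_sub_groupProb_nonneg _ _) (Real.one_sub_le_exp_neg _) _
      _ = Real.exp (-(groupProb d m (d ^ 3) * (d : ℝ) ^ i)) := by
          rw [← Real.exp_nat_mul]; push_cast; ring_nf
      _ ≤ _ := by
          rw [Real.exp_le_exp, neg_le_neg_iff]
          exact le_groupProb_mul_pow hd hik hmm
  · gcongr
    have : i ≤ (m + 1) * (m + 1) := by omega
    rw [sq]
    exact_mod_cast this

/-! ### Early finish: numerical estimates -/

lemma prod_inv_pow_eq_rpow (hd : 2 ≤ d) {M : ℕ} (hM : M ≤ k) :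
    ∏ j ∈ Finset.range M, ((d : ℝ)⁻¹) ^ (k - j) =
      (d : ℝ) ^ (-((k : ℝ) * M - M * (M - 1) / 2)) := by
  have hd' : (0 : ℝ) < d := by have : 0 < d := by omega
                               exact_mod_cast this
  induction M with
  | zero => simp
  | succ M ih =>
    rw [Finset.prod_range_succ, ih (by omega), inv_pow, ← Real.rpow_natCast, ← Real.rpow_neg hd'.le,
      ← Real.rpow_add hd', Nat.cast_sub (by omega)]
    congr 1
    push_cast
    ring

lemma choose_le_mul_exp_div_pow (t n : ℕ) :
    (t.choose n : ℝ) ≤ ((t : ℝ) * Real.exp 1 / n) ^ n := by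
  rcases Nat.eq_zero_or_pos n with rfl | hn
  · simp
  have hn' : (0 : ℝ) < n := by exact_mod_cast hn
  have h1 : (t.choose n : ℝ) ≤ (t : ℝ) ^ n / n.factorial := Nat.choose_le_pow_div n t
  have h2 := Real.pow_div_factorial_le_exp (n : ℝ) hn'.le n
  have h3 : (0 : ℝ) < n.factorial := by exact_mod_cast n.factorial_pos
  refine h1.trans ?_
  rw [div_pow, mul_pow, ← Real.exp_nat_mul, mul_one, div_le_div_iff₀ h3 (by positivity), mul_assoc]
  rw [div_le_iff₀ h3] at h2
  gcongr

lemma walkLaw_early (hd : 2 ≤ d) (hk : 8 ≤ k) {w : ℝ} (hw : Real.exp 1 ≤ w) :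
    (walkLaw d k).real {ρ | (finishTime ρ : ℝ) < Tf d k / w} ≤ Real.exp 1 / w := by
  have : NeZero d := ⟨by omega⟩
  have hd' : (2 : ℝ) ≤ d := by exact_mod_cast hd
  have hw0 : 0 < w := (Real.exp_pos 1).trans_le hw
  set m := Nat.sqrt (2 * k) with hm
  have hmm : m * m ≤ 2 * k := Nat.sqrt_le _
  have hmm' : 2 * k < (m + 1) * (m + 1) := Nat.lt_succ_sqrt _
  -- Rounding up gives `y ≤ M ≤ y + 1` for `y = √(2k)`; both inequalities enter the exponent.
  set M := m + 1 with hM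
  have hMk : M ≤ k := by nlinarith
  set y := √(2 * (k : ℝ)) with hy
  have hyy : y * y = 2 * k := Real.mul_self_sqrt (by positivity)
  have hy0 : 0 ≤ y := Real.sqrt_nonneg _
  have hMy : (M : ℝ) ≤ y + 1 := by
    have : (m : ℝ) ≤ y := by
      apply Real.le_sqrt_of_sq_le
      rw [sq]; exact_mod_cast hmm
    rw [hM]; push_cast; linarith
  have hyM : y ≤ M := by
    rw [hy, Real.sqrt_le_left (by positivity), sq]
    exact_mod_cast hmm'.le
  have hky : √(k : ℝ) ≤ y := Real.sqrt_le_sqrt (by linarith [Nat.cast_nonneg (α := ℝ) k])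
  set t := ⌊Tf d k / w⌋₊ with ht
  have hT0 : 0 ≤ Tf d k := by unfold Tf; positivity
  have htT : (t : ℝ) ≤ Tf d k / w := Nat.floor_le (by positivity)
  have hsub : {ρ : ℕ → Walk d k | (finishTime ρ : ℝ) < Tf d k / w} ⊆ {ρ | finishTime ρ ≤ t} :=
    fun ρ h => Nat.le_floor (le_of_lt h)
  refine (measureReal_mono hsub (measure_ne_top _ _)).trans ((walkLaw_finishTime_le hMk t).trans ?_)
  rw [prod_inv_pow_eq_rpow hd hMk]
  have hbase : (t : ℝ) * Real.exp 1 / ((M + 1 : ℕ) : ℝ) ≤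
      Real.exp 1 / w * (d : ℝ) ^ ((k : ℝ) - y) := by
    rw [div_le_iff₀ (by positivity)]
    -- The denominator `M + 1` from the binomial coefficient absorbs the factor `√k` of `T_f`.
    have hkM : √(k : ℝ) ≤ ((M + 1 : ℕ) : ℝ) := by push_cast; linarith
    calc (t : ℝ) * Real.exp 1 ≤ Tf d k / w * Real.exp 1 := by gcongr
      _ = Real.exp 1 / w * (d : ℝ) ^ ((k : ℝ) - y) * √(k : ℝ) := by rw [Tf]; ring
      _ ≤ _ := by gcongr
  have hexpo : (d : ℝ) ^ (((k : ℝ) - y) * ((M + 1 : ℕ) : ℝ)) *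
      (d : ℝ) ^ (-((k : ℝ) * M - M * (M - 1) / 2)) ≤ 1 := by
    rw [← Real.rpow_add (by linarith)]
    refine Real.rpow_le_one_of_one_le_of_nonpos (by linarith) ?_
    push_cast
    -- By `y ^ 2 = 2k`, the total exponent `k - yM - y + M(M - 1)/2` is at most `-y/2`.
    have h1 : (M : ℝ) * (M - 1) ≤ (y + 1) * y := by
      have : (1 : ℝ) ≤ M := by rw [hM]; push_cast; linarith [Nat.cast_nonneg (α := ℝ) m]
      exact mul_le_mul hMy (by linarith) (by linarith) (by linarith)
    have h2 : y * y ≤ y * M := mul_le_mul_of_nonneg_left hyM hy0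
    linarith
  have hle1 : Real.exp 1 / w ≤ 1 := (div_le_one hw0).2 hw
  calc (t.choose (M + 1) : ℝ) * (d : ℝ) ^ (-((k : ℝ) * M - M * (M - 1) / 2))
      ≤ (Real.exp 1 / w * (d : ℝ) ^ ((k : ℝ) - y)) ^ (M + 1) *
        (d : ℝ) ^ (-((k : ℝ) * M - M * (M - 1) / 2)) := by
        gcongr
        exact (choose_le_mul_exp_div_pow t (M + 1)).trans
          (pow_le_pow_left₀ (by positivity) hbase _)
    _ = (Real.exp 1 / w) ^ (M + 1) * ((d : ℝ) ^ (((k : ℝ) - y) * ((M + 1 : ℕ) : ℝ)) *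
        (d : ℝ) ^ (-((k : ℝ) * M - M * (M - 1) / 2))) := by
        rw [mul_pow, Real.rpow_mul (by linarith), Real.rpow_natCast]; ring
    _ ≤ (Real.exp 1 / w) ^ (M + 1) * 1 := by gcongr
    _ ≤ Real.exp 1 / w := by
        rw [mul_one]
        exact pow_le_of_le_one (by positivity) hle1 (by omega)

/-! ### Convergence and the binary case -/

lemma tendsto_walkLaw_finishWithin (hd : 2 ≤ d) (ω : ℕ → ℝ) (hω : Tendsto ω atTop atTop) :
    Tendsto (fun k : ℕ => walkLaw d k (finishWithin d k (ω k) (Tf d k))) atTop (𝓝 1) := by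
  have : NeZero d := ⟨by omega⟩
  have hsqrt : Tendsto (fun k : ℕ => Nat.sqrt (2 * k)) atTop atTop := by
    refine tendsto_atTop.2 fun b => eventually_atTop.2 ⟨b * b, fun k hk => ?_⟩
    rw [Nat.le_sqrt]
    omega
  have herr : Tendsto (fun k : ℕ => 1 - (Real.exp 1 / ω k + lateBound d (Nat.sqrt (2 * k))))
      atTop (𝓝 1) := by
    have h := (tendsto_const_nhds (x := (1 : ℝ))).sub
      ((hω.const_div_atTop (Real.exp 1)).add ((tendsto_lateBound d).comp hsqrt))
    simpa using h
  have hreal : Tendsto (fun k : ℕ => (walkLaw d k).real (finishWithin d k (ω k) (Tf d k)))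
      atTop (𝓝 1) := by
    refine tendsto_of_tendsto_of_tendsto_of_le_of_le' herr tendsto_const_nhds ?_
      (Eventually.of_forall fun k => measureReal_le_one)
    filter_upwards [eventually_ge_atTop 8, hω.eventually_ge_atTop (Real.exp 1),
      hω.eventually_ge_atTop (12 * (d : ℝ) ^ 4)] with k hk hw hw'
    have hT0 : 0 ≤ Tf d k := by unfold Tf; positivity
    -- Covering the whole space and using subadditivity bounds the good event from below without
    -- proving it measurable.
    have hcover : (Set.univ : Set (ℕ → Walk d k)) ⊆ finishWithin d k (ω k) (Tf d k) ∪
        ({ρ | (finishTime ρ : ℝ) < Tf d k / ω k} ∪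
          {ρ | 12 * (d : ℝ) ^ 4 * Tf d k < finishTime ρ}) := by
      intro ρ _
      by_cases h1 : (finishTime ρ : ℝ) < Tf d k / ω k
      · exact Or.inr (Or.inl h1)
      by_cases h2 : 12 * (d : ℝ) ^ 4 * Tf d k < finishTime ρ
      · exact Or.inr (Or.inr h2)
      · exact Or.inl ⟨not_lt.1 h1, (not_lt.1 h2).trans (mul_le_mul_of_nonneg_right hw' hT0)⟩
    have h1 : (1 : ℝ) ≤ _ := probReal_univ (μ := walkLaw d k) ▸
      measureReal_mono hcover (measure_ne_top _ _)
    have h2 := measureReal_union_le (μ := walkLaw d k) (finishWithin d k (ω k) (Tf d k))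
      ({ρ | (finishTime ρ : ℝ) < Tf d k / ω k} ∪ {ρ | 12 * (d : ℝ) ^ 4 * Tf d k < finishTime ρ})
    have h3 := measureReal_union_le (μ := walkLaw d k) {ρ | (finishTime ρ : ℝ) < Tf d k / ω k}
      {ρ | 12 * (d : ℝ) ^ 4 * Tf d k < finishTime ρ}
    have h4 := walkLaw_early hd hk hw
    have h5 := walkLaw_late hd (show 2 ≤ k by omega)
    linarith
  have h := ENNReal.tendsto_ofReal hreal
  rw [ENNReal.ofReal_one] at h
  exact h.congr fun k => ofReal_measureReal

lemma hastingsHalsey_eq (k : ℕ) : hastingsHalsey k = √2 * Tf 2 k := by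
  rw [hastingsHalsey, Tf, Real.sqrt_mul (by norm_num)]
  push_cast
  ring

/-- The two scales differ by the factor `√2`, which is absorbed by shrinking `w`. -/
lemma finishWithin_Tf_subset {w : ℝ} (hw : 0 ≤ w) :
    finishWithin 2 k (w / √2) (Tf 2 k) ⊆ finishWithin 2 k w (hastingsHalsey k) := by
  have hT0 : 0 ≤ Tf 2 k := by unfold Tf; positivity
  have h2 : (1 : ℝ) ≤ √2 := Real.one_le_sqrt.2 (by norm_num)
  rintro ρ ⟨h1, h3⟩
  refine ⟨le_trans (le_of_eq ?_) h1, h3.trans ?_⟩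
  · rw [hastingsHalsey_eq, div_div_eq_mul_div, mul_comm]
  · rw [hastingsHalsey_eq]
    have h4 : w / √2 ≤ w := div_le_self hw h2
    calc w / √2 * Tf 2 k ≤ w * Tf 2 k := by gcongr
      _ ≤ w * (√2 * Tf 2 k) := by
        gcongr
        exact le_mul_of_one_le_left hT0 h2

end DLA

end

theorem corollary2 :
    (∀ d : ℕ, 2 ≤ d → ∀ ω : ℕ → ℝ, Tendsto ω atTop atTop →
      Tendsto (fun k : ℕ => DLA.walkLaw d k (DLA.finishWithin d k (ω k) (DLA.Tf d k)))
        atTop (𝓝 1)) ∧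
    (∀ ω : ℕ → ℝ, Tendsto ω atTop atTop →
      Tendsto (fun k : ℕ => DLA.walkLaw 2 k (DLA.finishWithin 2 k (ω k) (DLA.hastingsHalsey k)))
        atTop (𝓝 1)) := by
  refine ⟨fun d hd ω hω => DLA.tendsto_walkLaw_finishWithin hd ω hω, fun ω hω => ?_⟩
  have h := DLA.tendsto_walkLaw_finishWithin le_rfl (fun k => ω k / √2)
    (hω.atTop_div_const (by positivity))
  refine tendsto_of_tendsto_of_tendsto_of_le_of_le' h tendsto_const_nhds ?_
    (Eventually.of_forall fun k => prob_le_one)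
  filter_upwards [hω.eventually_ge_atTop 0] with k hk
  exact measure_mono (DLA.finishWithin_Tf_subset hk)
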